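/- There are absolute constants $c>0$ and $\varepsilon_0>0$ such that the following holds for all integers $n,d$ with $1\le d\le n/2$ and all $\varepsilon\in(0,\varepsilon_0]$. A degree-$d$ Bayes net over $\{0,1\}^n$ is a probability distribution on $\{0,1\}^n$ that is Markov with respect to (i.e. factorizes according to) some directed acyclic graph on the $n$ coordinates in which every node has at most $d$ parents. An $m$-sample tester for a class $\mathcal C$ of distributions on $\{0,1\}^n$ is a randomized algorithm that, given $m$ i.i.d. samples from an unknown $P\in\mathcal C$, accepts with probability at least $2/3$ if $P$ is a product distribution (its $n$ coordinates are mutually independent) and rejects with probability at least $2/3$ if $P$ is at total variation distance at least $\varepsilon$ from every product distribution on $\{0,1\}^n$. (i) Every $m$-sample tester for the class of all degree-$d$ Bayes nets over $\{0,1\}^n$ satisfies $m\ge c\,2^{d/2}\sqrt n/\varepsilon^2$; that is, testing whether an arbitrary degree-$d$ Bayes net is a product distribution or $\varepsilon$-far from every product distribution requires $\Omega(2^{d/2}\sqrt n/\varepsilon^2)$ samples. (ii) This holds even if the structure is known: for all such $n,d$ there is a directed acyclic graph $G$ on $n$ nodes with at most $d$ parents per node, not depending on $\varepsilon$, such that for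 every $\varepsilon\in(0,\varepsilon_0]$ every $m$-sample tester (which may depend on $G$) for the class of distributions that are Markov with respect to $G$ satisfies $m\ge c\,2^{d/2}\sqrt n/\varepsilon^2$. -/

import Mathlib

namespace IndepTesting

/-- The product of finitely many probability distributions on finite types: the law of a tuple
of independent random variables, the `i`-th one having law `q i`. -/
noncomputable def prodPMF {ι Ω : Type} [Fintype ι] [DecidableEq ι] [Fintype Ω]
    (q : ι → PMF Ω) : PMF (ι → Ω) :=
  PMF.ofFintype (fun x => ∏ i, q i (x i)) (by
    rw [← Fintype.piFinset_univ, ← Finset.prod_univ_sum]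
    refine Finset.prod_eq_one fun i _ => ?_
    rw [← tsum_fintype (L := .unconditional _), PMF.tsum_coe])

/-- The law of `m` independent samples from `P`. -/
noncomputable def samples {Ω : Type} [Fintype Ω] (m : ℕ) (P : PMF Ω) : PMF (Fin m → Ω) :=
  prodPMF fun _ => P

/-- Total variation distance between distributions on a finite domain. -/
noncomputable def dTV {Ω : Type} [Fintype Ω] (P Q : PMF Ω) : ℝ :=
  (1 / 2) * ∑ x, |(P x).toReal - (Q x).toReal|

/-- A directed acyclic graph on `n` nodes, given by the set of parents of every node. -/
structure DAG (n : ℕ) where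
  parents : Fin n → Finset (Fin n)
  acyclic : ∀ i, ¬ Relation.TransGen (fun j k => j ∈ parents k) i i

/-- Every node has at most `d` parents. -/
def DAG.HasDegree {n : ℕ} (G : DAG n) (d : ℕ) : Prop :=
  ∀ i, (G.parents i).card ≤ d

/-- `P` is Markov with respect to `G` (has structure `G`): it factorizes as the product, over
the nodes `i`, of conditional distributions of the `i`-th bit given the bits of its parents. -/
def IsMarkov {n : ℕ} (G : DAG n) (P : PMF (Fin n → Bool)) : Prop :=
  ∃ p : (i : Fin n) → ({j : Fin n // j ∈ G.parents i} → Bool) → PMF Bool,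
    ∀ x, P x = ∏ i, p i (fun j => x j.1) (x i)

/-- `P` is a degree-`d` Bayes net. -/
def IsBayesNet {n : ℕ} (d : ℕ) (P : PMF (Fin n → Bool)) : Prop :=
  ∃ G : DAG n, G.HasDegree d ∧ IsMarkov G P

/-- `P` is a product distribution: its `n` coordinates are mutually independent. -/
def IsProduct {n : ℕ} (P : PMF (Fin n → Bool)) : Prop :=
  ∃ q : Fin n → PMF Bool, P = prodPMF q

/-- `P` is `ε`-far, in total variation distance, from every product distribution. -/
def IsFarFromProduct {n : ℕ} (ε : ℝ) (P : PMF (Fin n → Bool)) : Prop :=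
  ∀ Q : PMF (Fin n → Bool), IsProduct Q → ε ≤ dTV P Q

/-- `T` is an independence tester, with distance parameter `ε`, for the class `C` of
distributions on `{0,1}^n`. It is a randomized algorithm: it takes `m` samples and returns a
random bit (`true` for accept). For every `P` in `C`, given `m` independent samples from `P`,
it accepts with probability at least `2/3` if `P` is a product distribution, and rejects with
probability at least `2/3` if `P` is `ε`-far from every product distribution. -/
def IsIndependenceTester {n m : ℕ} (C : Set (PMF (Fin n → Bool))) (ε : ℝ)
    (T : (Fin m → Fin n → Bool) → PMF Bool) : Prop :=
  ∀ P ∈ C,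
    (IsProduct P → 2 / 3 ≤ ((samples m P).bind T) true) ∧
    (IsFarFromProduct ε P → 2 / 3 ≤ ((samples m P).bind T) false)

end IndepTesting

/-! Write d = e + 1 and n = d + k, so that k ≥ n/2. The hard nets have d uniform bits that are the
common parents of the other k bits. Each child has conditional bias ±δ, with sign (sign of bit 0) ·
z(b)_i, where b is the string of the other e parents and z is an arbitrary table of signs. Flipping
bit 0 reverses every bias. Hence for every z, not just for most, the net is at distance of order
√k·δ from all products (`netPMF_isFarFromProduct`), and δ ≈ ε/√k makes this ε. A tester separates
the uniform law from the mixture of the nets over z, so the m-sample likelihood ratio of the mixture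
has second moment at least 10/9 (`second_moment_of_distinguishes`). That moment averages over z, z'
the m-th power of the mean over b of ∏ (1 + δ² z(b)_i z'(b)_i). The 2^e blocks are independent and
each product is a martingale, so it is at most exp(2m²kδ⁴/2^e) (`sum_sum_pow_le`). Thus m² ≳
2^e/(kδ⁴) ≈ 2^e k/ε⁴. -/

namespace IndepTesting

/-- The sign `1` or `-1` of a bit. -/
noncomputable def bitSign (b : Bool) : ℝ := if b then 1 else -1

@[simp] lemma bitSign_true : bitSign true = 1 := rfl

@[simp] lemma bitSign_false : bitSign false = -1 := rfl

@[simp] lemma abs_bitSign (b : Bool) : |bitSign b| = 1 := by cases b <;> simp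

lemma sum_prod_bool {ι : Type} [Fintype ι] [DecidableEq ι] (f : ι → Bool → ℝ) :
    ∑ y : ι → Bool, ∏ i, f i (y i) = ∏ i, (f i true + f i false) := by
  rw [← Fintype.piFinset_univ, ← Finset.prod_univ_sum]
  simp

/-! ### Exponential moments of products over random signs -/

/-- An Azuma-type bound for the product martingale `∏ (1 + η i * w i)`, `w` uniform signs. -/
lemma sum_exp_prod_le (k : ℕ) (η : Fin k → ℝ) {h K : ℝ} (lam : ℝ) (h0 : 0 ≤ h)
    (hη : ∀ i, |η i| ≤ h) (hK : (1 + h) ^ k ≤ K) :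
    ∑ w : Fin k → Bool, Real.exp (lam * ∏ i, (1 + η i * bitSign (w i))) ≤
      2 ^ k * Real.exp (lam + k * (lam ^ 2 * K ^ 2 * h ^ 2 / 2)) := by
  induction k with
  | zero => simp
  | succ k ih =>
    have hK' : (1 + h) ^ k ≤ K :=
      (pow_le_pow_right₀ (by linarith) (Nat.le_succ k)).trans hK
    have ih' := ih (fun i => η i.castSucc) (fun i => hη _) hK'
    rw [← (Fin.snocEquiv fun _ => Bool).sum_comp, Fintype.sum_prod_type, Fintype.sum_bool,
      ← Finset.sum_add_distrib]
    have step : ∀ w : Fin k → Bool,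
        Real.exp (lam * ∏ i, (1 + η i * bitSign ((Fin.snocEquiv fun _ => Bool) (true, w) i))) +
        Real.exp (lam * ∏ i, (1 + η i * bitSign ((Fin.snocEquiv fun _ => Bool) (false, w) i))) ≤
        2 * Real.exp (lam ^ 2 * K ^ 2 * h ^ 2 / 2) *
          Real.exp (lam * ∏ i : Fin k, (1 + η i.castSucc * bitSign (w i))) := by
      intro w
      simp only [Fin.prod_univ_castSucc, Fin.snocEquiv_apply, Fin.snoc_castSucc, Fin.snoc_last,
        bitSign_true, bitSign_false]
      set Y := ∏ i : Fin k, (1 + η i.castSucc * bitSign (w i)) with hY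
      have hYK : |Y| ≤ K := by
        rw [hY, Finset.abs_prod]
        refine le_trans ?_ hK'
        calc ∏ i : Fin k, |1 + η i.castSucc * bitSign (w i)| ≤ ∏ _i : Fin k, (1 + h) := by
              refine Finset.prod_le_prod (fun _ _ => abs_nonneg _) fun i _ => ?_
              refine (abs_add_le _ _).trans ?_
              rw [abs_mul, abs_bitSign]
              simpa using hη i.castSucc
          _ = (1 + h) ^ k := by simp
      -- Averaging over the last sign gives a cosh; its sub-Gaussian bound costs one increment `lam
      -- ^ 2 * K ^ 2 * h ^ 2 / 2`.
      have hc := Real.cosh_le_exp_half_sq (lam * Y * η (Fin.last k))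
      have e1 : Real.exp (lam * (Y * (1 + η (Fin.last k) * 1))) +
          Real.exp (lam * (Y * (1 + η (Fin.last k) * -1))) =
          2 * Real.cosh (lam * Y * η (Fin.last k)) * Real.exp (lam * Y) := by
        rw [Real.cosh_eq, show lam * (Y * (1 + η (Fin.last k) * 1)) =
          lam * Y * η (Fin.last k) + lam * Y by ring,
          show lam * (Y * (1 + η (Fin.last k) * -1)) =
          -(lam * Y * η (Fin.last k)) + lam * Y by ring, Real.exp_add, Real.exp_add]
        ring
      rw [e1]
      have hYsq : Y ^ 2 ≤ K ^ 2 := sq_le_sq' (abs_le.1 hYK).1 (abs_le.1 hYK).2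
      have hηsq : η (Fin.last k) ^ 2 ≤ h ^ 2 :=
        sq_le_sq' (abs_le.1 (hη _)).1 (abs_le.1 (hη _)).2
      have h2 : (lam * Y * η (Fin.last k)) ^ 2 / 2 ≤ lam ^ 2 * K ^ 2 * h ^ 2 / 2 := by
        rw [mul_pow, mul_pow]
        gcongr
      gcongr
      exact hc.trans (Real.exp_le_exp.2 h2)
    refine (Finset.sum_le_sum fun w _ => step w).trans ?_
    rw [← Finset.mul_sum]
    refine (mul_le_mul_of_nonneg_left ih' (by positivity)).trans (le_of_eq ?_)
    rw [show lam + ((k + 1 : ℕ) : ℝ) * (lam ^ 2 * K ^ 2 * h ^ 2 / 2) =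
      lam ^ 2 * K ^ 2 * h ^ 2 / 2 + (lam + k * (lam ^ 2 * K ^ 2 * h ^ 2 / 2)) by push_cast; ring,
      Real.exp_add (lam ^ 2 * K ^ 2 * h ^ 2 / 2)]
    ring

/-- The blocks `w b` range independently, so the sum factors over `b`. -/
lemma sum_exp_sum_prod_le {β : Type} [Fintype β] [DecidableEq β] (k : ℕ) (η : β → Fin k → ℝ)
    {h K : ℝ} (lam : ℝ) (h0 : 0 ≤ h) (hη : ∀ b i, |η b i| ≤ h) (hK : (1 + h) ^ k ≤ K) :
    ∑ w : β → Fin k → Bool, Real.exp (∑ b, lam * ∏ i, (1 + η b i * bitSign (w b i))) ≤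
      (2 ^ k * Real.exp (lam + k * (lam ^ 2 * K ^ 2 * h ^ 2 / 2))) ^ Fintype.card β := by
  simp only [Real.exp_sum]
  rw [← Fintype.piFinset_univ, ← Finset.prod_univ_sum (fun _ => Finset.univ)
    (fun b (v : Fin k → Bool) => Real.exp (lam * ∏ i, (1 + η b i * bitSign (v i))))]
  refine (Finset.prod_le_prod (fun b _ => Finset.sum_nonneg fun _ _ => (Real.exp_pos _).le)
    fun b _ => sum_exp_prod_le k (η b) lam h0 (hη b) hK).trans (le_of_eq ?_)
  simp [Finset.prod_const]

/-! ### Lower bound on an L¹ distance by the fourth moment method -/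

lemma sum_pow_mul_pow (k : ℕ) (δ : ℝ) (c : Fin k → Bool) (j l : ℕ) :
    ∑ y : Fin k → Bool, (∏ i, (1 + δ * (bitSign (y i) * bitSign (c i)))) ^ j *
        (∏ i, (1 - δ * (bitSign (y i) * bitSign (c i)))) ^ l =
      ((1 + δ) ^ j * (1 - δ) ^ l + (1 - δ) ^ j * (1 + δ) ^ l) ^ k := by
  simp only [← Finset.prod_pow, ← Finset.prod_mul_distrib]
  rw [sum_prod_bool fun i b => (1 + δ * (bitSign b * bitSign (c i))) ^ j *
    (1 - δ * (bitSign b * bitSign (c i))) ^ l]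
  rw [← Fin.prod_const]
  refine Finset.prod_congr rfl fun i _ => ?_
  cases c i <;> simp [sub_eq_add_neg, add_comm]

/-- Bounds a first absolute moment below by second and fourth moments, which are computable exactly.
With u = |y|/M it reads u ≥ u² - u⁴/4. -/
lemma abs_ge_sq_sub_pow_four (y : ℝ) {M : ℝ} (hM : 0 < M) :
    y ^ 2 / M - y ^ 4 / (4 * M ^ 3) ≤ |y| := by
  obtain ⟨u, hu⟩ : ∃ u, u = |y| / M := ⟨_, rfl⟩
  have hy : |y| = M * u := by rw [hu]; field_simp
  have hu0 : 0 ≤ u := by rw [hu]; positivity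
  have e2 : y ^ 2 = (M * u) ^ 2 := by rw [← hy, sq_abs]
  have e4 : y ^ 4 = (M * u) ^ 4 := by
    rw [show y ^ 4 = (y ^ 2) ^ 2 by ring, e2]; ring
  rw [e2, e4, hy]
  have : (M * u) ^ 2 / M - (M * u) ^ 4 / (4 * M ^ 3) = M * (u ^ 2 - u ^ 4 / 4) := by
    field_simp
  rw [this]
  refine mul_le_mul_of_nonneg_left ?_ hM.le
  have key : 0 ≤ 1 - u + u ^ 3 / 4 := by
    nlinarith [mul_nonneg hu0 (sq_nonneg (u - 1)), sq_nonneg (u - 1)]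
  nlinarith [mul_nonneg hu0 key]

/-- The `L¹` distance between two product distributions on `k` bits with opposite biases `δ`. -/
lemma le_sum_abs_prod_sub_prod {k : ℕ} (hk : 1 ≤ k) {δ : ℝ} (c : Fin k → Bool)
    (hx0 : 0 < k * δ ^ 2) (hx : k * δ ^ 2 ≤ 1 / 7) :
    2 ^ k * (√(k * δ ^ 2) / 6) ≤
      ∑ y : Fin k → Bool, |∏ i, (1 + δ * (bitSign (y i) * bitSign (c i))) -
        ∏ i, (1 - δ * (bitSign (y i) * bitSign (c i)))| := by
  set x := k * δ ^ 2 with hxdef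
  have hk' : (1 : ℝ) ≤ k := by exact_mod_cast hk
  have hδx : δ ^ 2 ≤ x := by nlinarith [sq_nonneg δ]
  set r := √x with hr
  have hr0 : 0 < r := Real.sqrt_pos.2 hx0
  have hrr : r ^ 2 = x := Real.sq_sqrt hx0.le
  set p : (Fin k → Bool) → ℝ := fun y => ∏ i, (1 + δ * (bitSign (y i) * bitSign (c i)))
  set q : (Fin k → Bool) → ℝ := fun y => ∏ i, (1 - δ * (bitSign (y i) * bitSign (c i)))
  have S : ∀ j l : ℕ, ∑ y, p y ^ j * q y ^ l =
      2 ^ k * ((((1 + δ) ^ j * (1 - δ) ^ l + (1 - δ) ^ j * (1 + δ) ^ l) / 2) ^ k) := by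
    intro j l
    rw [← mul_pow, mul_div_cancel₀ _ (two_ne_zero)]
    exact sum_pow_mul_pow k δ c j l
  have m2 : ∑ y, (p y - q y) ^ 2 = 2 ^ k * (2 * (1 + δ ^ 2) ^ k - 2 * (1 - δ ^ 2) ^ k) := by
    have : ∀ y, (p y - q y) ^ 2 =
      p y ^ 2 * q y ^ 0 - 2 * (p y ^ 1 * q y ^ 1) + p y ^ 0 * q y ^ 2 := fun y => by ring
    simp only [this, Finset.sum_add_distrib, Finset.sum_sub_distrib, ← Finset.mul_sum, S]
    rw [show ((1 + δ) ^ 2 * (1 - δ) ^ 0 + (1 - δ) ^ 2 * (1 + δ) ^ 0) / 2 = 1 + δ ^ 2 by ring,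
      show ((1 + δ) ^ 0 * (1 - δ) ^ 2 + (1 - δ) ^ 0 * (1 + δ) ^ 2) / 2 = 1 + δ ^ 2 by ring,
      show ((1 + δ) ^ 1 * (1 - δ) ^ 1 + (1 - δ) ^ 1 * (1 + δ) ^ 1) / 2 = 1 - δ ^ 2 by ring]
    ring
  have m4 : ∑ y, (p y - q y) ^ 4 = 2 ^ k * (2 * (1 + 6 * δ ^ 2 + δ ^ 4) ^ k -
      8 * (1 - δ ^ 4) ^ k + 6 * ((1 - δ ^ 2) ^ 2) ^ k) := by
    have : ∀ y, (p y - q y) ^ 4 = p y ^ 4 * q y ^ 0 - 4 * (p y ^ 3 * q y ^ 1) +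
      6 * (p y ^ 2 * q y ^ 2) - 4 * (p y ^ 1 * q y ^ 3) + p y ^ 0 * q y ^ 4 := fun y => by ring
    simp only [this, Finset.sum_add_distrib, Finset.sum_sub_distrib, ← Finset.mul_sum, S]
    rw [show ((1 + δ) ^ 4 * (1 - δ) ^ 0 + (1 - δ) ^ 4 * (1 + δ) ^ 0) / 2
        = 1 + 6 * δ ^ 2 + δ ^ 4 by ring,
      show ((1 + δ) ^ 0 * (1 - δ) ^ 4 + (1 - δ) ^ 0 * (1 + δ) ^ 4) / 2
        = 1 + 6 * δ ^ 2 + δ ^ 4 by ring,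
      show ((1 + δ) ^ 3 * (1 - δ) ^ 1 + (1 - δ) ^ 3 * (1 + δ) ^ 1) / 2 = 1 - δ ^ 4 by ring,
      show ((1 + δ) ^ 1 * (1 - δ) ^ 3 + (1 - δ) ^ 1 * (1 + δ) ^ 3) / 2 = 1 - δ ^ 4 by ring,
      show ((1 + δ) ^ 2 * (1 - δ) ^ 2 + (1 - δ) ^ 2 * (1 + δ) ^ 2) / 2 = (1 - δ ^ 2) ^ 2 by ring]
    ring
  have hδ1 : δ ^ 2 ≤ 1 := by linarith
  have lower2 : 2 * x ≤ 2 * (1 + δ ^ 2) ^ k - 2 * (1 - δ ^ 2) ^ k := by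
    have h1 := one_add_mul_le_pow (a := δ ^ 2) (by nlinarith [sq_nonneg δ]) k
    have h2 : (1 - δ ^ 2) ^ k ≤ 1 := pow_le_one₀ (by linarith) (by nlinarith [sq_nonneg δ])
    linarith
  -- The orders 0 and 1 in x cancel: 2 - 8 + 6 = 0 and 12 - 12 = 0. The remainders add up to 2·(1 +
  -- 49) + 8 + 6·4 = 132.
  have upper4 : 2 * (1 + 6 * δ ^ 2 + δ ^ 4) ^ k - 8 * (1 - δ ^ 4) ^ k +
      6 * ((1 - δ ^ 2) ^ 2) ^ k ≤ 132 * x ^ 2 := by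
    have hxd : k * δ ^ 4 = x * δ ^ 2 := by rw [hxdef]; ring
    have hxd2 : x * δ ^ 2 ≤ x * x := mul_le_mul_of_nonneg_left hδx hx0.le
    have hxd0 : 0 ≤ x * δ ^ 2 := by positivity
    have h1 : (1 + 6 * δ ^ 2 + δ ^ 4) ^ k ≤ 1 + (6 * x + x * δ ^ 2) + 49 * x ^ 2 := by
      have hy : |6 * x + x * δ ^ 2| ≤ 1 := by
        rw [abs_of_nonneg (by positivity)]; nlinarith
      have hb := Real.abs_exp_sub_one_sub_id_le hy
      have hb' := (abs_le.1 hb).2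
      have : (1 + 6 * δ ^ 2 + δ ^ 4) ^ k ≤ Real.exp (6 * x + x * δ ^ 2) := by
        rw [show 6 * x + x * δ ^ 2 = k * (6 * δ ^ 2 + δ ^ 4) by rw [hxdef]; ring, Real.exp_nat_mul]
        refine pow_le_pow_left₀ (by positivity) ?_ k
        linarith [Real.add_one_le_exp (6 * δ ^ 2 + δ ^ 4)]
      have hsq : (6 * x + x * δ ^ 2) ^ 2 ≤ (7 * x) ^ 2 :=
        pow_le_pow_left₀ (by positivity) (by nlinarith) 2
      nlinarith
    have h2 : 1 - x * δ ^ 2 ≤ (1 - δ ^ 4) ^ k := by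
      have := one_add_mul_le_pow (a := -δ ^ 4) (by nlinarith [sq_nonneg δ]) k
      rw [show (1 : ℝ) - δ ^ 4 = 1 + -δ ^ 4 by ring, ← hxd]
      linarith
    have h3 : ((1 - δ ^ 2) ^ 2) ^ k ≤ 1 - 2 * x + 4 * x ^ 2 := by
      have hy : |-(2 * x)| ≤ 1 := by
        rw [abs_neg, abs_of_nonneg (by positivity)]; linarith
      have hb' := (abs_le.1 (Real.abs_exp_sub_one_sub_id_le hy)).2
      have : ((1 - δ ^ 2) ^ 2) ^ k ≤ Real.exp (-(2 * x)) := by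
        rw [show -(2 * x) = k * (-(δ ^ 2) + -(δ ^ 2)) by rw [hxdef]; ring, Real.exp_nat_mul,
          Real.exp_add, ← sq]
        have h4 := Real.add_one_le_exp (-(δ ^ 2))
        refine pow_le_pow_left₀ (by positivity) (pow_le_pow_left₀ (by linarith) (by linarith) 2) k
      nlinarith
    nlinarith
  -- At scale M = 6√x the second moment contributes at least r/3, and the fourth removes at most
  -- 132r/864 ≤ r/6.
  have hM : 0 < 6 * r := by positivity
  have main : ∑ y, ((p y - q y) ^ 2 / (6 * r) - (p y - q y) ^ 4 / (4 * (6 * r) ^ 3)) ≤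
      ∑ y, |p y - q y| := Finset.sum_le_sum fun y _ => abs_ge_sq_sub_pow_four _ hM
  refine le_trans ?_ main
  rw [Finset.sum_sub_distrib, ← Finset.sum_div, ← Finset.sum_div, m2, m4, mul_div_assoc,
    mul_div_assoc, ← mul_sub]
  refine mul_le_mul_of_nonneg_left ?_ (by positivity)
  have a1 : r / 3 ≤ (2 * (1 + δ ^ 2) ^ k - 2 * (1 - δ ^ 2) ^ k) / (6 * r) := by
    rw [le_div_iff₀ hM]; nlinarith
  have a2 : (2 * (1 + 6 * δ ^ 2 + δ ^ 4) ^ k - 8 * (1 - δ ^ 4) ^ k +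
      6 * ((1 - δ ^ 2) ^ 2) ^ k) / (4 * (6 * r) ^ 3) ≤ r / 6 := by
    rw [div_le_iff₀ (by positivity)]
    refine upper4.trans ?_
    rw [← hrr]
    nlinarith [pow_pos hr0 4]
  linarith

/-! ### Testing against a mixture, and distance to products -/

/-- Le Cam's method with the second moment of the likelihood ratios. -/
lemma second_moment_of_distinguishes {S Z : Type} [Fintype S] [Fintype Z] [Nonempty Z]
    {u : S → ℝ} {L : Z → S → ℝ} {φ : S → ℝ} (hu : ∀ s, 0 ≤ u s) (hu1 : ∑ s, u s = 1)
    (hL : ∀ z, ∑ s, u s * L z s = 1) (hφ0 : ∀ s, 0 ≤ φ s) (hφ1 : ∀ s, φ s ≤ 1)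
    (h0 : 2 / 3 ≤ ∑ s, u s * φ s) (h1 : ∀ z, ∑ s, u s * L z s * φ s ≤ 1 / 3) :
    10 / 9 * (Fintype.card Z : ℝ) ^ 2 ≤ ∑ z, ∑ z', ∑ s, u s * (L z s * L z' s) := by
  set N : ℝ := (Fintype.card Z : ℝ) with hN
  have hNpos : 0 < N := by rw [hN]; exact_mod_cast Fintype.card_pos
  set M : S → ℝ := fun s => ∑ z, L z s with hM
  have e1 : ∑ z, ∑ z', ∑ s, u s * (L z s * L z' s) = ∑ s, u s * M s ^ 2 := by
    have : ∀ s, u s * M s ^ 2 = ∑ z, ∑ z', u s * (L z s * L z' s) := by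
      intro s
      rw [hM, sq, Finset.sum_mul_sum]
      simp only [Finset.mul_sum]
    simp only [this]
    symm
    rw [Finset.sum_comm]
    refine Finset.sum_congr rfl fun z _ => ?_
    rw [Finset.sum_comm]
  have e2 : ∑ s, u s * M s = N := by
    simp only [hM, Finset.mul_sum]
    rw [Finset.sum_comm]
    simp [hL, hN]
  have e3 : ∑ s, u s * M s * φ s ≤ N / 3 := by
    simp only [hM, Finset.mul_sum, Finset.sum_mul]
    rw [Finset.sum_comm]
    refine (Finset.sum_le_sum fun z _ => h1 z).trans (le_of_eq ?_)
    simp [hN]; ring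
  have e4 : ∑ s, u s * φ s ^ 2 ≤ 1 := by
    rw [← hu1]
    refine Finset.sum_le_sum fun s _ => ?_
    nlinarith [mul_nonneg (hu s) (sub_nonneg.2 (pow_le_one₀ (hφ0 s) (hφ1 s) (n := 2)))]
  -- Cauchy–Schwarz as a nonnegative square: `N - M` has correlation at least N/3 with `φ`, whose
  -- second moment is at most 1, and N/3 is the optimal multiplier.
  have pos : 0 ≤ ∑ s, u s * (N - M s - N / 3 * φ s) ^ 2 :=
    Finset.sum_nonneg fun s _ => mul_nonneg (hu s) (sq_nonneg _)
  have expand : ∑ s, u s * (N - M s - N / 3 * φ s) ^ 2 =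
      N ^ 2 * ∑ s, u s + ∑ s, u s * M s ^ 2 + N ^ 2 / 9 * ∑ s, u s * φ s ^ 2
      - 2 * N * ∑ s, u s * M s - 2 * N ^ 2 / 3 * ∑ s, u s * φ s
      + 2 * N / 3 * ∑ s, u s * M s * φ s := by
    simp only [Finset.mul_sum, ← Finset.sum_add_distrib, ← Finset.sum_sub_distrib]
    exact Finset.sum_congr rfl fun s _ => by ring
  rw [expand, hu1, e2] at pos
  rw [e1]
  nlinarith [mul_le_mul_of_nonneg_left e3 hNpos.le, mul_le_mul_of_nonneg_left h0 (sq_nonneg N),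
    mul_le_mul_of_nonneg_left e4 (sq_nonneg N)]

/-- A distribution with uniform first marginal and conditionals `p a` is far from every product
`v ⊗ r`, if flipping a bit of `a` always changes the conditional by at least `D` in `L¹`. -/
lemma le_sum_abs_sub_mul {β Y : Type} [Fintype β] [Fintype Y] [Nonempty β]
    {p : Bool → β → Y → ℝ} {v : Bool → β → ℝ} {r : Y → ℝ} {D : ℝ}
    (hp : ∀ a b, ∑ y, p a b y = 1) (hr0 : ∀ y, 0 ≤ r y) (hr : ∑ y, r y = 1)
    (hD : ∀ b, D ≤ ∑ y, |p true b y - p false b y|) :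
    D / 4 ≤ ∑ a, ∑ b, ∑ y, |(2 * (Fintype.card β : ℝ))⁻¹ * p a b y - v a b * r y| := by
  set N : ℝ := (Fintype.card β : ℝ) with hN
  have hNpos : 0 < N := by rw [hN]; exact_mod_cast Fintype.card_pos
  set w := (2 * N)⁻¹ with hw
  have hw0 : 0 < w := by positivity
  set T := ∑ a, ∑ b, ∑ y, |w * p a b y - v a b * r y| with hT
  have t1 : ∑ a, ∑ b, |w - v a b| ≤ T := by
    refine Finset.sum_le_sum fun a _ => Finset.sum_le_sum fun b _ => ?_
    refine le_trans (le_of_eq ?_) (Finset.abs_sum_le_sum_abs _ _)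
    rw [Finset.sum_sub_distrib, ← Finset.mul_sum, ← Finset.mul_sum, hp, hr, mul_one, mul_one]
  -- Replacing `v` by the uniform weight costs only the error of the first marginal, itself at most
  -- `T` by `t1`.
  have t2 : ∑ a, ∑ b, ∑ y, |w * p a b y - w * r y| ≤ T + ∑ a, ∑ b, |w - v a b| := by
    rw [hT]
    simp only [← Finset.sum_add_distrib]
    refine Finset.sum_le_sum fun a _ => Finset.sum_le_sum fun b _ => ?_
    have : |w - v a b| = ∑ y, |w - v a b| * r y := by rw [← Finset.mul_sum, hr, mul_one]
    rw [this, ← Finset.sum_add_distrib]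
    refine Finset.sum_le_sum fun y _ => ?_
    have e : |w - v a b| * r y = |v a b * r y - w * r y| := by
      rw [← sub_mul, abs_mul, abs_of_nonneg (hr0 y), abs_sub_comm]
    rw [e]
    exact abs_sub_le _ _ _
  -- For each `b`, one law `r` cannot be close to both conditionals. Altogether D/2 ≤ 2T.
  have t3 : w * (N * D) ≤ ∑ a, ∑ b, ∑ y, |w * p a b y - w * r y| := by
    rw [Fintype.sum_bool, ← Finset.sum_add_distrib]
    have : w * (N * D) = ∑ _b : β, w * D := by simp [hN]; ring
    rw [this]
    refine Finset.sum_le_sum fun b _ => ?_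
    rw [← Finset.sum_add_distrib]
    refine (mul_le_mul_of_nonneg_left (hD b) hw0.le).trans ?_
    rw [Finset.mul_sum]
    refine Finset.sum_le_sum fun y _ => ?_
    rw [← abs_of_pos hw0, ← abs_mul, abs_of_pos hw0, mul_sub]
    refine (abs_sub_le _ (w * r y) _).trans ?_
    rw [abs_sub_comm (w * r y)]
  have : w * (N * D) = D / 2 := by rw [hw]; field_simp
  linarith


/-! ### The hard family of Bayes nets -/

/-- The random bit whose sign has mean `t`. -/
noncomputable def biasedBit (t : ℝ) (ht : |t| ≤ 1) : PMF Bool :=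
  PMF.ofFintype (fun b => ENNReal.ofReal ((1 + t * bitSign b) / 2)) (by
    have := abs_le.1 ht
    rw [Fintype.sum_bool, ← ENNReal.ofReal_add, ← ENNReal.ofReal_one]
    · congr 1
      simp only [bitSign_true, bitSign_false]
      ring
    · simp only [bitSign_true]
      linarith
    · simp only [bitSign_false]
      linarith)

lemma biasedBit_apply (t : ℝ) (ht : |t| ≤ 1) (b : Bool) :
    biasedBit t ht b = ENNReal.ofReal ((1 + t * bitSign b) / 2) := rfl

/-- The graph in which the first `e + 1` nodes are the parents of each of the other `k` nodes. -/
def pointerGraph (e k : ℕ) : DAG (e + 1 + k) where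
  parents := Fin.addCases (fun _ => ∅) (fun _ => Finset.univ.map (Fin.castAddEmb k))
  acyclic := by
    have hlt : ∀ j i : Fin (e + 1 + k), j ∈ (Fin.addCases (motive := fun _ => Finset (Fin (e + 1 + k)))
        (fun _ => ∅) (fun _ => Finset.univ.map (Fin.castAddEmb k)) i) → j < i := by
      intro j i
      refine Fin.addCases (fun i => ?_) (fun i => ?_) i
      · simp
      · simp only [Fin.addCases_right, Finset.mem_map, Finset.mem_univ, true_and]
        rintro ⟨a, rfl⟩
        simp only [Fin.lt_def, Fin.castAddEmb_apply, Fin.val_castAdd, Fin.val_natAdd]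
        omega
    intro i hi
    have : ∀ a b, Relation.TransGen (fun j k' : Fin (e + 1 + k) =>
        j ∈ (Fin.addCases (motive := fun _ => Finset (Fin (e + 1 + k)))
        (fun _ => ∅) (fun _ => Finset.univ.map (Fin.castAddEmb k)) k')) a b → a < b := by
      intro a b h
      induction h with
      | single h => exact hlt _ _ h
      | tail _ h ih => exact ih.trans (hlt _ _ h)
    exact lt_irrefl _ (this i i hi)

lemma pointerGraph_hasDegree (e k : ℕ) : (pointerGraph e k).HasDegree (e + 1) := by
  intro i
  refine Fin.addCases (fun i => ?_) (fun i => ?_) i <;> simp [pointerGraph]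

lemma castAdd_mem_parents (e k : ℕ) (j : Fin (e + 1)) (i : Fin k) :
    Fin.castAdd k j ∈ (pointerGraph e k).parents (Fin.natAdd (e + 1) i) := by
  simp [pointerGraph]

/-- The density, relative to the uniform distribution, of the Bayes net in which the first `e + 1`
bits are uniform and each of the other bits has a conditional bias `± δ`, whose sign is the
product of the sign of the bit `0` and of a sign depending on the next `e` bits. -/
noncomputable def netDensity {e k : ℕ} (δ : ℝ) (z : (Fin e → Bool) → Fin k → Bool)
    (x : Fin (e + 1 + k) → Bool) : ℝ :=
  ∏ i : Fin k, (1 + δ * (bitSign (x (Fin.natAdd (e + 1) i)) *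
    (bitSign (x (Fin.castAdd k 0)) * bitSign (z (fun j => x (Fin.castAdd k j.succ)) i))))

lemma netDensity_append {e k : ℕ} (δ : ℝ) (z : (Fin e → Bool) → Fin k → Bool) (a : Bool)
    (b : Fin e → Bool) (y : Fin k → Bool) :
    netDensity δ z (Fin.append (Fin.cons a b : Fin (e + 1) → Bool) y) =
      ∏ i : Fin k, (1 + δ * (bitSign (y i) * (bitSign a * bitSign (z b i)))) := by
  simp [netDensity]

lemma netDensity_nonneg {e k : ℕ} {δ : ℝ} (hδ : |δ| ≤ 1) (z : (Fin e → Bool) → Fin k → Bool)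
    (x : Fin (e + 1 + k) → Bool) : 0 ≤ netDensity δ z x := by
  refine Finset.prod_nonneg fun i _ => ?_
  have : |δ * (bitSign (x (Fin.natAdd (e + 1) i)) *
    (bitSign (x (Fin.castAdd k 0)) * bitSign (z (fun j => x (Fin.castAdd k j.succ)) i)))| ≤ 1 := by
    simpa [abs_mul] using hδ
  linarith [(abs_le.1 this).1]

lemma sum_eq_sum_append {e k : ℕ} (F : (Fin (e + 1 + k) → Bool) → ℝ) :
    ∑ x, F x = ∑ a : Bool, ∑ b : Fin e → Bool, ∑ y : Fin k → Bool,
      F (Fin.append (Fin.cons a b : Fin (e + 1) → Bool) y) := by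
  rw [← (Fin.appendEquiv (e + 1) k).sum_comp, Fintype.sum_prod_type,
    ← (Fin.consEquiv fun _ => Bool).sum_comp, Fintype.sum_prod_type]
  rfl

lemma sum_netDensity_append {e k : ℕ} (δ : ℝ) (z : (Fin e → Bool) → Fin k → Bool) (a : Bool)
    (b : Fin e → Bool) :
    ∑ y : Fin k → Bool, netDensity δ z (Fin.append (Fin.cons a b : Fin (e + 1) → Bool) y) =
      2 ^ k := by
  simp only [netDensity_append]
  rw [sum_prod_bool fun i c => 1 + δ * (bitSign c * (bitSign a * bitSign (z b i))),
    ← Fin.prod_const]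
  refine Finset.prod_congr rfl fun i _ => ?_
  simp only [bitSign_true, bitSign_false]
  ring

lemma sum_netDensity {e k : ℕ} (δ : ℝ) (z : (Fin e → Bool) → Fin k → Bool) :
    ∑ x, (2⁻¹ : ℝ) ^ (e + 1 + k) * netDensity δ z x = 1 := by
  rw [← Finset.mul_sum, sum_eq_sum_append]
  simp only [sum_netDensity_append]
  simp only [Finset.sum_const, Finset.card_univ, Fintype.card_bool, Fintype.card_fun,
    Fintype.card_fin, nsmul_eq_mul]
  push_cast
  rw [inv_pow, pow_add, pow_succ]
  field_simp

/-- The correlation of two of the densities. -/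
lemma sum_netDensity_mul_netDensity {e k : ℕ} (δ : ℝ) (z z' : (Fin e → Bool) → Fin k → Bool) :
    ∑ x, (2⁻¹ : ℝ) ^ (e + 1 + k) * (netDensity δ z x * netDensity δ z' x) =
      (2 ^ e)⁻¹ * ∑ b, ∏ i, (1 + δ ^ 2 * bitSign (z b i) * bitSign (z' b i)) := by
  have key : ∀ a b, ∑ y : Fin k → Bool,
      (netDensity δ z (Fin.append (Fin.cons a b : Fin (e + 1) → Bool) y) *
        netDensity δ z' (Fin.append (Fin.cons a b : Fin (e + 1) → Bool) y)) =
      2 ^ k * ∏ i, (1 + δ ^ 2 * bitSign (z b i) * bitSign (z' b i)) := by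
    intro a b
    simp only [netDensity_append, ← Finset.prod_mul_distrib]
    rw [sum_prod_bool fun i c => (1 + δ * (bitSign c * (bitSign a * bitSign (z b i)))) *
      (1 + δ * (bitSign c * (bitSign a * bitSign (z' b i)))), ← Fin.prod_const,
      ← Finset.prod_mul_distrib]
    refine Finset.prod_congr rfl fun i _ => ?_
    -- The terms linear in δ cancel over the child bit, and the sign of bit 0 occurs squared.
    cases a <;> simp only [bitSign_true, bitSign_false] <;> ring
  rw [← Finset.mul_sum, sum_eq_sum_append]
  simp only [key, ← Finset.mul_sum, Fintype.sum_bool]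
  rw [inv_pow, pow_add, pow_succ]
  field_simp
  ring

/-- The Bayes net with density `netDensity δ z`. -/
noncomputable def netPMF {e k : ℕ} (δ : ℝ) (hδ : |δ| ≤ 1) (z : (Fin e → Bool) → Fin k → Bool) :
    PMF (Fin (e + 1 + k) → Bool) :=
  PMF.ofFintype (fun x => ENNReal.ofReal ((2⁻¹ : ℝ) ^ (e + 1 + k) * netDensity δ z x)) (by
    rw [← ENNReal.ofReal_sum_of_nonneg, sum_netDensity, ENNReal.ofReal_one]
    intro x _
    exact mul_nonneg (by positivity) (netDensity_nonneg hδ z x))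

lemma netPMF_apply {e k : ℕ} (δ : ℝ) (hδ : |δ| ≤ 1) (z : (Fin e → Bool) → Fin k → Bool)
    (x : Fin (e + 1 + k) → Bool) :
    netPMF δ hδ z x = ENNReal.ofReal ((2⁻¹ : ℝ) ^ (e + 1 + k) * netDensity δ z x) := rfl

lemma toReal_netPMF {e k : ℕ} (δ : ℝ) (hδ : |δ| ≤ 1) (z : (Fin e → Bool) → Fin k → Bool)
    (x : Fin (e + 1 + k) → Bool) :
    (netPMF δ hδ z x).toReal = (2⁻¹ : ℝ) ^ (e + 1 + k) * netDensity δ z x := by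
  rw [netPMF_apply, ENNReal.toReal_ofReal]
  exact mul_nonneg (by positivity) (netDensity_nonneg hδ z x)

lemma netPMF_isMarkov {e k : ℕ} (δ : ℝ) (hδ : |δ| ≤ 1) (z : (Fin e → Bool) → Fin k → Bool) :
    IsMarkov (pointerGraph e k) (netPMF δ hδ z) := by
  refine ⟨Fin.addCases (motive := fun i =>
      ({j // j ∈ (pointerGraph e k).parents i} → Bool) → PMF Bool)
    (fun _ _ => biasedBit 0 (by simp))
    (fun i c => biasedBit (δ * (bitSign (c ⟨_, castAdd_mem_parents e k 0 i⟩) *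
        bitSign (z (fun j => c ⟨_, castAdd_mem_parents e k j.succ i⟩) i)))
      (by simpa [abs_mul] using hδ)), fun x => ?_⟩
  have hnn : ∀ i : Fin k, 0 ≤ (1 + δ * (bitSign (x (Fin.castAdd k 0)) *
      bitSign (z (fun j => x (Fin.castAdd k j.succ)) i)) *
        bitSign (x (Fin.natAdd (e + 1) i))) / 2 := by
    intro i
    have : |δ * (bitSign (x (Fin.castAdd k 0)) *
      bitSign (z (fun j => x (Fin.castAdd k j.succ)) i)) *
        bitSign (x (Fin.natAdd (e + 1) i))| ≤ 1 := by simpa [abs_mul] using hδ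
    linarith [(abs_le.1 this).1]
  rw [Fin.prod_univ_add]
  simp only [Fin.addCases_left, Fin.addCases_right, biasedBit_apply]
  rw [← ENNReal.ofReal_prod_of_nonneg (fun i _ => by norm_num),
    ← ENNReal.ofReal_prod_of_nonneg (fun i _ => hnn i),
    ← ENNReal.ofReal_mul (Finset.prod_nonneg fun i _ => by norm_num), netPMF_apply]
  congr 1
  simp only [netDensity, Finset.prod_div_distrib, zero_mul, add_zero, Finset.prod_const_one,
    Finset.prod_const, Finset.card_univ, Fintype.card_fin]
  rw [pow_add, inv_pow 2 k, one_div, mul_assoc, div_eq_inv_mul]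
  refine congrArg₂ _ (inv_pow _ _) (congrArg₂ _ rfl (Finset.prod_congr rfl fun i _ => ?_))
  ring

lemma netPMF_zero_isProduct {e k : ℕ} (z : (Fin e → Bool) → Fin k → Bool) :
    IsProduct (netPMF 0 (by simp) z) := by
  refine ⟨fun _ => biasedBit 0 (by simp), ?_⟩
  ext x
  change _ = ∏ i, biasedBit 0 _ (x i)
  simp only [biasedBit_apply, netPMF_apply]
  rw [← ENNReal.ofReal_prod_of_nonneg (fun i _ => by norm_num)]
  simp [netDensity]

/-! ### From testers to real sums, and the sample bound -/

lemma sum_toReal_eq_one {Ω : Type} [Fintype Ω] (P : PMF Ω) : ∑ x, (P x).toReal = 1 := by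
  rw [← ENNReal.toReal_sum fun x _ => P.apply_ne_top x, ← tsum_fintype (L := .unconditional _),
    P.tsum_coe, ENNReal.toReal_one]

lemma toReal_prodPMF {ι Ω : Type} [Fintype ι] [DecidableEq ι] [Fintype Ω] (q : ι → PMF Ω)
    (x : ι → Ω) : (prodPMF q x).toReal = ∏ i, (q i (x i)).toReal := by
  change (∏ i, q i (x i)).toReal = _
  rw [ENNReal.toReal_prod]

lemma toReal_samples_bind {Ω : Type} [Fintype Ω] {m : ℕ} (P : PMF Ω)
    (T : (Fin m → Ω) → PMF Bool) (b : Bool) :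
    (((samples m P).bind T) b).toReal = ∑ s, (∏ j, (P (s j)).toReal) * (T s b).toReal := by
  rw [PMF.bind_apply, tsum_fintype, ENNReal.toReal_sum fun s _ =>
    ENNReal.mul_ne_top (PMF.apply_ne_top _ _) (PMF.apply_ne_top _ _)]
  refine Finset.sum_congr rfl fun s _ => ?_
  rw [ENNReal.toReal_mul, samples, toReal_prodPMF]

lemma two_thirds_le_toReal {P : PMF Bool} {b : Bool} (h : 2 / 3 ≤ P b) :
    2 / 3 ≤ (P b).toReal := by
  have := ENNReal.toReal_mono (P.apply_ne_top b) h
  simpa using this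

/-- The second moment of the likelihood ratio of `m` samples. -/
lemma sum_sum_pow_le {e k m : ℕ} {δ : ℝ} (hδ : δ ^ 2 ≤ 1) (hx : k * δ ^ 2 ≤ 1 / 7)
    (z : (Fin e → Bool) → Fin k → Bool) :
    ∑ z' : (Fin e → Bool) → Fin k → Bool,
      ((2 ^ e)⁻¹ * ∑ b, ∏ i, (1 + δ ^ 2 * bitSign (z b i) * bitSign (z' b i))) ^ m ≤
      Fintype.card ((Fin e → Bool) → Fin k → Bool) *
        Real.exp (2 * m ^ 2 * k * δ ^ 4 / 2 ^ e) := by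
  have hK : (1 + δ ^ 2) ^ k ≤ 2 := by
    have h1 : (1 + δ ^ 2) ^ k ≤ Real.exp (k * δ ^ 2) := by
      rw [Real.exp_nat_mul]
      refine pow_le_pow_left₀ (by positivity) ?_ k
      linarith [Real.add_one_le_exp (δ ^ 2)]
    have h2 := Real.add_one_le_exp (-(k * δ ^ 2))
    have h3 : Real.exp (k * δ ^ 2) * Real.exp (-(k * δ ^ 2)) = 1 := by
      rw [← Real.exp_add]; simp
    nlinarith [Real.exp_pos (k * δ ^ 2)]
  have main := sum_exp_sum_prod_le k (fun b i => δ ^ 2 * bitSign (z b i)) (m / 2 ^ e : ℝ)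
    (sq_nonneg δ) (fun b i => by simp [abs_mul]) hK
  -- τ^m ≤ exp(m(τ - 1)) makes the average over `b` a sum in the exponent; the factor exp(-m) later
  -- cancels the first-order term `lam` · 2^e = m.
  have step : ∀ z' : (Fin e → Bool) → Fin k → Bool,
      ((2 ^ e)⁻¹ * ∑ b, ∏ i, (1 + δ ^ 2 * bitSign (z b i) * bitSign (z' b i))) ^ m ≤
      Real.exp (-m) * Real.exp (∑ b, (m / 2 ^ e : ℝ) *
        ∏ i, (1 + δ ^ 2 * bitSign (z b i) * bitSign (z' b i))) := by
    intro z'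
    have hnn : 0 ≤ (2 ^ e : ℝ)⁻¹ * ∑ b, ∏ i, (1 + δ ^ 2 * bitSign (z b i) * bitSign (z' b i)) := by
      refine mul_nonneg (by positivity) (Finset.sum_nonneg fun b _ =>
        Finset.prod_nonneg fun i _ => ?_)
      have : |δ ^ 2 * bitSign (z b i) * bitSign (z' b i)| ≤ 1 := by simpa [abs_mul] using hδ
      linarith [(abs_le.1 this).1]
    rw [← Finset.mul_sum, ← Real.exp_add]
    set τ := (2 ^ e : ℝ)⁻¹ * ∑ b, ∏ i, (1 + δ ^ 2 * bitSign (z b i) * bitSign (z' b i)) with hτ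
    have : -(m : ℝ) + m / 2 ^ e * ∑ b, ∏ i, (1 + δ ^ 2 * bitSign (z b i) * bitSign (z' b i)) =
      m * (τ - 1) := by rw [hτ]; ring
    rw [this, Real.exp_nat_mul]
    exact pow_le_pow_left₀ hnn (by linarith [Real.add_one_le_exp (τ - 1)]) m
  refine (Finset.sum_le_sum fun z' _ => step z').trans ?_
  rw [← Finset.mul_sum]
  refine (mul_le_mul_of_nonneg_left main (Real.exp_pos _).le).trans (le_of_eq ?_)
  simp only [Fintype.card_fun, Fintype.card_bool, Fintype.card_fin]
  push_cast
  rw [mul_pow, ← Real.exp_nat_mul, mul_left_comm, ← Real.exp_add]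
  congr 2
  push_cast
  field_simp
  ring

/-- The number of samples needed to tell the uniform distribution from all the nets. -/
lemma two_pow_le_of_distinguishes {e k m : ℕ} {δ : ℝ} (hδ : |δ| ≤ 1) (hx : k * δ ^ 2 ≤ 1 / 7)
    {T : (Fin m → Fin (e + 1 + k) → Bool) → PMF Bool}
    (h0 : ∀ z : (Fin e → Bool) → Fin k → Bool,
      2 / 3 ≤ ((samples m (netPMF 0 (by simp) z)).bind T) true)
    (h1 : ∀ z : (Fin e → Bool) → Fin k → Bool,
      2 / 3 ≤ ((samples m (netPMF δ hδ z)).bind T) false) :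
    (2 : ℝ) ^ e ≤ 20 * m ^ 2 * k * δ ^ 4 := by
  have hδ2 : δ ^ 2 ≤ 1 := by rw [← sq_abs]; exact pow_le_one₀ (abs_nonneg δ) hδ
  set Z := (Fin e → Bool) → Fin k → Bool
  have hsum : ∀ F : (Fin (e + 1 + k) → Bool) → ℝ,
      ∑ s : Fin m → Fin (e + 1 + k) → Bool, (∏ _j : Fin m, (2⁻¹ : ℝ) ^ (e + 1 + k)) *
        ∏ j, F (s j) = (∑ x, (2⁻¹ : ℝ) ^ (e + 1 + k) * F x) ^ m := by
    intro F
    rw [Fintype.sum_pow]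
    exact Finset.sum_congr rfl fun s _ => by rw [Finset.prod_mul_distrib]
  have hT : ∀ s, (T s true).toReal + (T s false).toReal = 1 := fun s => by
    rw [← sum_toReal_eq_one (T s), Fintype.sum_bool]
  have key := second_moment_of_distinguishes (Z := Z)
    (u := fun _ : Fin m → Fin (e + 1 + k) → Bool => ∏ _j : Fin m, (2⁻¹ : ℝ) ^ (e + 1 + k))
    (L := fun z s => ∏ j, netDensity δ z (s j)) (φ := fun s => (T s true).toReal)
    (fun s => by positivity)
    (by
      have := hsum fun _ => 1
      simp only [Finset.prod_const_one, mul_one] at this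
      rw [this]
      simp)
    (fun z => by
      rw [hsum (netDensity δ z), sum_netDensity, one_pow])
    (fun s => ENNReal.toReal_nonneg)
    (fun s => by linarith [hT s, ENNReal.toReal_nonneg (a := T s false)])
    (by
      -- At δ = 0 every table gives the uniform law, so any `z` serves.
      have := two_thirds_le_toReal (h0 fun _ _ => true)
      rw [toReal_samples_bind] at this
      simpa [toReal_netPMF, netDensity] using this)
    (fun z => by
      have := two_thirds_le_toReal (h1 z)
      have h2 := sum_toReal_eq_one ((samples m (netPMF δ hδ z)).bind T)
      rw [Fintype.sum_bool] at h2
      have h3 := toReal_samples_bind (netPMF δ hδ z) T true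
      simp only [toReal_netPMF, Finset.prod_mul_distrib] at h3
      rw [← h3]
      linarith)
  have e1 : ∀ z z' : Z, ∑ s : Fin m → Fin (e + 1 + k) → Bool,
      (∏ _j : Fin m, (2⁻¹ : ℝ) ^ (e + 1 + k)) *
        ((∏ j, netDensity δ z (s j)) * ∏ j, netDensity δ z' (s j)) =
      ((2 ^ e)⁻¹ * ∑ b, ∏ i, (1 + δ ^ 2 * bitSign (z b i) * bitSign (z' b i))) ^ m := by
    intro z z'
    rw [← sum_netDensity_mul_netDensity, ← hsum]
    simp only [Finset.prod_mul_distrib]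
  simp only [e1] at key
  have key2 := key.trans (Finset.sum_le_sum fun z _ => sum_sum_pow_le (m := m) hδ2 hx z)
  rw [Finset.sum_const, Finset.card_univ, nsmul_eq_mul] at key2
  have hZ : (0 : ℝ) < Fintype.card Z := by exact_mod_cast Fintype.card_pos
  set y := 2 * (m : ℝ) ^ 2 * k * δ ^ 4 / 2 ^ e with hy
  have hexp : 10 / 9 ≤ Real.exp y := by
    have : 0 < (Fintype.card Z : ℝ) ^ 2 := by positivity
    refine le_of_mul_le_mul_right ?_ this
    linarith
  have hy2 : 1 / 10 ≤ y := by
    have h2 := Real.add_one_le_exp (-y)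
    have h3 : Real.exp y * Real.exp (-y) = 1 := by rw [← Real.exp_add]; simp
    nlinarith [Real.exp_pos (-y)]
  rw [hy, le_div_iff₀ (by positivity)] at hy2
  linarith

/-- The conditionals for the two values of bit 0 have opposite biases, hence are √(kδ²)/6 apart in
L¹. The constant is 48 = 6·4·2: `le_sum_abs_sub_mul` loses 4 and total variation halves L¹. -/
lemma netPMF_isFarFromProduct {e k : ℕ} (hk : 1 ≤ k) {δ : ℝ} (hδ : |δ| ≤ 1)
    (hx0 : 0 < k * δ ^ 2) (hx : k * δ ^ 2 ≤ 1 / 7) (z : (Fin e → Bool) → Fin k → Bool) :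
    IsFarFromProduct (√(k * δ ^ 2) / 48) (netPMF δ hδ z) := by
  rintro Q ⟨q, rfl⟩
  rw [dTV, sum_eq_sum_append]
  have hQ : ∀ a b y, (prodPMF q (Fin.append (Fin.cons a b : Fin (e + 1) → Bool) y)).toReal =
      (∏ i : Fin (e + 1), (q (Fin.castAdd k i) ((Fin.cons a b : Fin (e + 1) → Bool) i)).toReal) *
      (prodPMF (fun i : Fin k => q (Fin.natAdd (e + 1) i)) y).toReal := by
    intro a b y
    rw [toReal_prodPMF, toReal_prodPMF, Fin.prod_univ_add]
    simp
  have hP : ∀ a b y, (netPMF δ hδ z (Fin.append (Fin.cons a b : Fin (e + 1) → Bool) y)).toReal =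
      (2 * (Fintype.card (Fin e → Bool) : ℝ))⁻¹ *
        ((2 ^ k)⁻¹ * netDensity δ z (Fin.append (Fin.cons a b : Fin (e + 1) → Bool) y)) := by
    intro a b y
    rw [toReal_netPMF, pow_add, pow_succ]
    simp only [Fintype.card_fun, Fintype.card_bool, Fintype.card_fin, inv_pow]
    push_cast
    field_simp
  simp only [hP, hQ]
  have := le_sum_abs_sub_mul (β := Fin e → Bool) (Y := Fin k → Bool)
    (p := fun a b y => (2 ^ k)⁻¹ *
      netDensity δ z (Fin.append (Fin.cons a b : Fin (e + 1) → Bool) y))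
    (v := fun a b => ∏ i : Fin (e + 1),
      (q (Fin.castAdd k i) ((Fin.cons a b : Fin (e + 1) → Bool) i)).toReal)
    (r := fun y => (prodPMF (fun i : Fin k => q (Fin.natAdd (e + 1) i)) y).toReal)
    (D := √(k * δ ^ 2) / 6)
    (fun a b => by
      rw [← Finset.mul_sum, sum_netDensity_append]
      field_simp)
    (fun y => ENNReal.toReal_nonneg) (sum_toReal_eq_one _)
    (fun b => by
      have h := le_sum_abs_prod_sub_prod hk (z b) hx0 hx
      simp only [netDensity_append, ← mul_sub, abs_mul, ← Finset.mul_sum, bitSign_true,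
        bitSign_false]
      rw [abs_of_pos (by positivity : (0 : ℝ) < (2 ^ k)⁻¹), le_inv_mul_iff₀ (by positivity)]
      simpa [sub_eq_add_neg] using h)
  linarith

/-- The sample complexity bound for the class of the distributions with structure
`pointerGraph e k`. -/
lemma sample_lower_bound {e k m : ℕ} (hk : e + 1 ≤ k) {ε : ℝ} (hε : 0 < ε) (hε' : ε ≤ 1 / 200)
    {T : (Fin m → Fin (e + 1 + k) → Bool) → PMF Bool}
    (hT : IsIndependenceTester {P | IsMarkov (pointerGraph e k) P} ε T) :
    1 / 20736 * ((2 : ℝ) ^ (((e + 1 : ℕ) : ℝ) / 2) * √((e + 1 + k : ℕ) : ℝ) / ε ^ 2) ≤ m := by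
  have hk1 : 1 ≤ k := by omega
  have hk0 : (1 : ℝ) ≤ k := by exact_mod_cast hk1
  -- Chosen so that √(kδ²)/48 = ε; then ε ≤ 1/200 gives kδ² ≤ 1/7.
  obtain ⟨δ, hδdef⟩ : ∃ δ : ℝ, δ = 48 * ε / √k := ⟨_, rfl⟩
  have hδ2 : δ ^ 2 = (48 * ε) ^ 2 / k := by
    rw [hδdef, div_pow, Real.sq_sqrt (by positivity)]
  have hx : k * δ ^ 2 = (48 * ε) ^ 2 := by rw [hδ2]; field_simp
  have hx7 : k * δ ^ 2 ≤ 1 / 7 := by rw [hx]; nlinarith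
  have hx0 : 0 < k * δ ^ 2 := by rw [hx]; positivity
  have hδ : |δ| ≤ 1 := by
    rw [← sq_le_one_iff_abs_le_one]
    nlinarith [sq_nonneg δ]
  have hfar : ∀ z : (Fin e → Bool) → Fin k → Bool, IsFarFromProduct ε (netPMF δ hδ z) := by
    intro z
    have := netPMF_isFarFromProduct hk1 hδ hx0 hx7 z
    rwa [hx, Real.sqrt_sq (by positivity), mul_div_cancel_left₀ _ (by norm_num)] at this
  have key := two_pow_le_of_distinguishes hδ hx7
    (fun z => (hT _ (netPMF_isMarkov 0 (by simp) z)).1 (netPMF_zero_isProduct z))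
    (fun z => (hT _ (netPMF_isMarkov δ hδ z)).2 (hfar z))
  -- 20736 = 9·48², and 4·20 ≤ 9².
  have key2 : (2 : ℝ) ^ (e + 1) * (e + 1 + k : ℕ) ≤ (20736 * (m * ε ^ 2)) ^ 2 := by
    have hn : ((e + 1 + k : ℕ) : ℝ) ≤ 2 * k := by exact_mod_cast (by omega : e + 1 + k ≤ 2 * k)
    have h1 : k * ((20 : ℝ) * m ^ 2 * k * δ ^ 4) = 20 * m ^ 2 * (48 * ε) ^ 4 := by
      rw [show k * ((20 : ℝ) * m ^ 2 * k * δ ^ 4) = 20 * m ^ 2 * (k * δ ^ 2) ^ 2 by ring, hx]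
      ring
    have h2 : (k : ℝ) * 2 ^ e ≤ 20 * m ^ 2 * (48 * ε) ^ 4 := by
      rw [← h1]; exact mul_le_mul_of_nonneg_left key (by positivity)
    have h3 : (2 : ℝ) ^ (e + 1) * (e + 1 + k : ℕ) ≤ 2 ^ (e + 1) * (2 * k) := by gcongr
    have h4 : 0 ≤ (m : ℝ) ^ 2 * ε ^ 4 := by positivity
    calc (2 : ℝ) ^ (e + 1) * (e + 1 + k : ℕ) ≤ 2 ^ (e + 1) * (2 * k) := h3
      _ = 4 * (k * 2 ^ e) := by ring
      _ ≤ 4 * (20 * m ^ 2 * (48 * ε) ^ 4) := by linarith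
      _ ≤ (20736 * (m * ε ^ 2)) ^ 2 := by nlinarith
  have e1 : (2 : ℝ) ^ (((e + 1 : ℕ) : ℝ) / 2) * √((e + 1 + k : ℕ) : ℝ) =
      √((2 : ℝ) ^ (e + 1) * (e + 1 + k : ℕ)) := by
    rw [Real.sqrt_mul (by positivity), ← Real.rpow_natCast 2 (e + 1), Real.sqrt_eq_rpow (2 ^ _),
      ← Real.rpow_mul (by norm_num)]
    congr 2
    ring
  have e2 := Real.sqrt_le_sqrt key2
  rw [Real.sqrt_sq (by positivity)] at e2
  rw [e1, ← mul_div_assoc, div_le_iff₀ (by positivity)]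
  linarith

end IndepTesting

theorem theoremB3 :
    ∃ c : ℝ, 0 < c ∧ ∃ ε₀ : ℝ, 0 < ε₀ ∧
      ∀ n d : ℕ, 1 ≤ d → (d : ℝ) ≤ (n : ℝ) / 2 →
        -- unknown structure: the tester has to work for all degree-`d` Bayes nets
        (∀ ε : ℝ, 0 < ε → ε ≤ ε₀ →
          ∀ (m : ℕ) (T : (Fin m → Fin n → Bool) → PMF Bool),
            IndepTesting.IsIndependenceTester {P | IndepTesting.IsBayesNet d P} ε T →
              c * ((2 : ℝ) ^ ((d : ℝ) / 2) * √(n : ℝ) / ε ^ 2) ≤ (m : ℝ)) ∧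
        -- known structure: the tester may depend on the degree-`d` graph `G` and has to work
        -- only for the distributions that are Markov with respect to `G`
        (∃ G : IndepTesting.DAG n, G.HasDegree d ∧
          ∀ ε : ℝ, 0 < ε → ε ≤ ε₀ →
            ∀ (m : ℕ) (T : (Fin m → Fin n → Bool) → PMF Bool),
              IndepTesting.IsIndependenceTester {P | IndepTesting.IsMarkov G P} ε T →
                c * ((2 : ℝ) ^ ((d : ℝ) / 2) * √(n : ℝ) / ε ^ 2) ≤ (m : ℝ)) := by
  refine ⟨1 / 20736, by norm_num, 1 / 200, by norm_num, fun n d hd hdn => ?_⟩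
  have hdn' : 2 * d ≤ n := by
    have : (2 : ℝ) * d ≤ n := by linarith
    exact_mod_cast this
  obtain ⟨e, rfl⟩ := Nat.exists_eq_add_of_le' hd
  obtain ⟨k, rfl⟩ := Nat.exists_eq_add_of_le (show e + 1 ≤ n by omega)
  have hk : e + 1 ≤ k := by omega
  refine ⟨fun ε hε hε' m T hT => ?_, IndepTesting.pointerGraph e k,
    IndepTesting.pointerGraph_hasDegree e k, fun ε hε hε' m T hT => ?_⟩
  -- A tester for all degree-d nets is in particular one for this graph.
  · exact IndepTesting.sample_lower_bound hk hε hε' fun P hP =>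
      hT P ⟨_, IndepTesting.pointerGraph_hasDegree e k, hP⟩
  · exact IndepTesting.sample_lower_bound hk hε hε' hT
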